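/- Let $q$ be an odd prime power, let $\mathbb{F}_q$ be the field with $q$ elements, let $d$ be a positive integer, and let $E \subseteq \mathbb{F}_q^d$ and $r \in \mathbb{F}_q$. For $x = (x_1, \ldots, x_d) \in \mathbb{F}_q^d$ write $\|x\| := x_1^2 + x_2^2 + \cdots + x_d^2 \in \mathbb{F}_q$. We say that $E$ contains a pair of $4$-paths with dilation ratio $r$ if there are five distinct points $x_1, \ldots, x_5 \in E$ and five distinct points $y_1, \ldots, y_5 \in E$ such that $\|y_{i+1} - y_i\| = r\,\|x_{i+1} - x_i\| \neq 0$ for $i = 1, 2, 3, 4$. Then $E$ contains a pair of $4$-paths with dilation ratio $r$ in each of the following cases: 1. $q \geq 5$, $d \in \{2, 4\}$, $r \neq 0$ and $|E| \geq 36\, q^{(2d+1)/3}$; 2. $d = 3$, $r$ is a nonzero square in $\mathbb{F}_q$ and $|E| \geq 9\, q^{(2d+1)/3} = 9\, q^{7/3}$; 3. $d = 5$, $r$ is a nonzero square in $\mathbb{F}_q$ and $|E| \geq 12\, q^{3}$; 4. $q \geq 5$, $d \geq 6$ is even, $r \neq 0$ and $|E| \geq 313\, q^{d/2}$; 5. $d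 \geq 7$ is odd, $r$ is a nonzero square in $\mathbb{F}_q$ and $|E| \geq 313\, q^{d/2}$. -/

import Mathlib

/-- The quadratic form `‖x‖ = x₁² + x₂² + ⋯ + x_d²` on `F ^ d`. -/
def sqNorm {F : Type*} [Field F] {d : ℕ} (x : Fin d → F) : F :=
  ∑ i, x i ^ 2

/-- `E ⊆ F ^ d` contains a pair of `G` with dilation ratio `r`, for a graph `G` on `n` vertices. -/
def ContainsPair {F : Type*} [Field F] {d n : ℕ} (G : SimpleGraph (Fin n))
    (E : Finset (Fin d → F)) (r : F) : Prop :=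
  ∃ x y : Fin n → (Fin d → F),
    Function.Injective x ∧ Function.Injective y ∧
    (∀ i, x i ∈ E) ∧ (∀ i, y i ∈ E) ∧
    ∀ i j, G.Adj i j →
      sqNorm (y i - y j) = r * sqNorm (x i - x j) ∧ r * sqNorm (x i - x j) ≠ 0

/-- The `k`-path: the path graph on `k + 1` vertices, which has `k` edges. -/
def kPath (k : ℕ) : SimpleGraph (Fin (k + 1)) :=
  SimpleGraph.pathGraph (k + 1)

/-! Join points of E × E by `dilationAdj`. A 4-path in this graph with distinct first coordinates
and distinct second coordinates is the required pair. Let N = `ratioCount` and Z = `zeroCount`; for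
r ≠ 0 there are N - Z² ordered adjacent pairs (`sum_dilationAdj`). If q(N - Z²) ≥ |E|⁴/2 and |E| ≥
27q, the average degree exceeds 12|E| + 2. Some induced subgraph then has minimum degree above 6|E|,
and a path can be grown greedily, since each earlier vertex forbids at most 2|E| neighbours.

The bound on N - Z² comes from Fourier analysis. Gauss sums turn `distSum` at -1/(4u) into `dualSum`
at u, and Parseval gives N the main term |E|⁴/q, a nonnegative dual energy and a small error
(`ratioCount_ge`). In even dimension the bound on Z involves the Fourier mass W on the isotropic
cone, which can be large. The dual energy contains W², and this cancels exactly the W² arising from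
Z². In odd dimension a quadratic character replaces the cone indicator and a trivial bound suffices.
Only |E|² ≥ 400 q^d is needed for this part. -/

/-! ### Gauss sums and Fourier duality for distances. -/

section CharacterSums

open Finset ComplexConjugate

variable {F : Type*} [Field F]

/-- The exponential sum over the values of `‖x - y‖` for `x, y ∈ E`. -/
noncomputable def distSum {d : ℕ} (ψ : AddChar F ℂ) (E : Finset (Fin d → F)) (s : F) : ℂ :=
  ∑ x ∈ E, ∑ y ∈ E, ψ (s * sqNorm (x - y))

/-- The squared absolute value of the Fourier transform of the indicator function of `E`. -/
noncomputable def fourierMass {d : ℕ} (ψ : AddChar F ℂ) (E : Finset (Fin d → F))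
    (m : Fin d → F) : ℝ :=
  ‖∑ x ∈ E, ψ (m ⬝ᵥ x)‖ ^ 2

theorem sqNorm_zero {d : ℕ} : sqNorm (0 : Fin d → F) = 0 := by
  simp [sqNorm]

theorem addChar_map_sum {ι : Type*} (ψ : AddChar F ℂ) (s : Finset ι) (f : ι → F) :
    ψ (∑ i ∈ s, f i) = ∏ i ∈ s, ψ (f i) := by
  classical
  induction s using Finset.induction_on with
  | empty => simp
  | insert a s ha ih => rw [sum_insert ha, prod_insert ha, AddChar.map_add_eq_mul, ih]

theorem fourierMass_nonneg {d : ℕ} (ψ : AddChar F ℂ) (E : Finset (Fin d → F))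
    (m : Fin d → F) : 0 ≤ fourierMass ψ E m := by
  unfold fourierMass; positivity

theorem distSum_eq {d : ℕ} (ψ : AddChar F ℂ) (E : Finset (Fin d → F)) (s : F) :
    distSum ψ E s = ∑ p ∈ E ×ˢ E, ψ (s * sqNorm (p.1 - p.2)) * ((1 : ℝ) : ℂ) := by
  simp [distSum, sum_product]

theorem distSum_zero {d : ℕ} (ψ : AddChar F ℂ) (E : Finset (Fin d → F)) :
    distSum ψ E 0 = (E.card : ℂ) ^ 2 := by
  simp [distSum, sq]

/-- The involution `u ↦ -(4u)⁻¹`, which fixes `0`. -/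
theorem involutive_neg_inv_four_mul (h2 : (2 : F) ≠ 0) :
    Function.Involutive fun u : F => -(4 * u)⁻¹ := by
  intro u
  have h4 : (4 : F) ≠ 0 := by
    have : (4 : F) = 2 * 2 := by norm_num
    rw [this]; exact mul_ne_zero h2 h2
  by_cases hu : u = 0
  · simp [hu]
  · simp only [mul_inv, mul_neg, inv_neg, neg_neg, inv_inv]
    field_simp

variable [Fintype F]

/-- The quadratic Gauss sum `∑ t, ψ (u t²)`. -/
noncomputable def quadSum (ψ : AddChar F ℂ) (u : F) : ℂ :=
  ∑ t, ψ (u * t ^ 2)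

/-- The exponential sum over the values of `‖m‖`, weighted by `fourierMass`. -/
noncomputable def dualSum {d : ℕ} (ψ : AddChar F ℂ) (E : Finset (Fin d → F)) (u : F) : ℂ :=
  ∑ m, ψ (u * sqNorm m) * (fourierMass ψ E m : ℂ)

theorem fourierMass_eq {d : ℕ} (ψ : AddChar F ℂ) (E : Finset (Fin d → F)) (m : Fin d → F) :
    (fourierMass ψ E m : ℂ) = ∑ x ∈ E, ∑ y ∈ E, ψ (m ⬝ᵥ (x - y)) := by
  unfold fourierMass
  push_cast
  rw [← Complex.mul_conj', map_sum, sum_mul_sum]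
  refine sum_congr rfl fun x _ => sum_congr rfl fun y _ => ?_
  rw [← AddChar.map_neg_eq_conj, ← AddChar.map_add_eq_mul, dotProduct_sub, sub_eq_add_neg]

theorem sum_addChar_mul [DecidableEq F] {ψ : AddChar F ℂ} (hψ : ψ.IsPrimitive) (b : F) :
    ∑ x, ψ (x * b) = if b = 0 then (Fintype.card F : ℂ) else 0 := by
  rw [AddChar.sum_mulShift b hψ]; split_ifs <;> simp

theorem sum_addChar_dotProduct [DecidableEq F] {d : ℕ} {ψ : AddChar F ℂ} (hψ : ψ.IsPrimitive)
    (z : Fin d → F) :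
    ∑ m : Fin d → F, ψ (m ⬝ᵥ z) = if z = 0 then (Fintype.card F : ℂ) ^ d else 0 := by
  have h : ∀ m : Fin d → F, ψ (m ⬝ᵥ z) = ∏ i, ψ (m i * z i) := fun m => by
    rw [dotProduct, addChar_map_sum]
  simp_rw [h]
  rw [← Fintype.prod_sum (fun i t => ψ (t * z i))]
  simp_rw [sum_addChar_mul hψ]
  split_ifs with hz
  · simp [hz]
  · obtain ⟨i, hi⟩ := Function.ne_iff.1 hz
    exact prod_eq_zero (mem_univ i) (if_neg hi)

theorem sum_fourierMass {d : ℕ} {ψ : AddChar F ℂ} (hψ : ψ.IsPrimitive)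
    (E : Finset (Fin d → F)) :
    ∑ m, fourierMass ψ E m = (Fintype.card F : ℝ) ^ d * E.card := by
  classical
  have : ((∑ m, fourierMass ψ E m : ℝ) : ℂ) = ((Fintype.card F : ℝ) ^ d * E.card : ℝ) := by
    push_cast
    simp_rw [fourierMass_eq]
    rw [sum_comm]
    have : ∀ x ∈ E, ∑ m, ∑ y ∈ E, ψ (m ⬝ᵥ (x - y)) = (Fintype.card F : ℂ) ^ d := by
      intro x hx
      rw [sum_comm]
      simp_rw [sum_addChar_dotProduct hψ, sub_eq_zero]
      simp [hx]
    rw [sum_congr rfl this]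
    simp [mul_comm]
  exact_mod_cast this

/-- Complete the square by shifting t by z/(2u). -/
theorem sum_addChar_quad {ψ : AddChar F ℂ} (h2 : (2 : F) ≠ 0) {u : F} (hu : u ≠ 0) (z : F) :
    ∑ t, ψ (u * t ^ 2 + t * z) = quadSum ψ u * ψ (-(z ^ 2) / (4 * u)) := by
  have h4 : (4 : F) ≠ 0 := by
    have : (4 : F) = 2 * 2 := by norm_num
    rw [this]; exact mul_ne_zero h2 h2
  unfold quadSum
  rw [sum_mul, ← Equiv.sum_comp (Equiv.subRight (z / (2 * u)))]
  refine sum_congr rfl fun t _ => ?_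
  rw [← AddChar.map_add_eq_mul]
  congr 1
  simp only [Equiv.subRight_apply]
  have h4' : (4 : F) = 2 * 2 := by norm_num
  rw [h4']
  field_simp
  ring

theorem sum_addChar_sqNorm {d : ℕ} {ψ : AddChar F ℂ} (h2 : (2 : F) ≠ 0) {u : F} (hu : u ≠ 0)
    (z : Fin d → F) :
    ∑ m : Fin d → F, ψ (u * sqNorm m + m ⬝ᵥ z) =
      quadSum ψ u ^ d * ψ (-(4 * u)⁻¹ * sqNorm z) := by
  have h : ∀ m : Fin d → F, ψ (u * sqNorm m + m ⬝ᵥ z) =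
      ∏ i, ψ (u * m i ^ 2 + m i * z i) := fun m => by
    rw [dotProduct, sqNorm, mul_sum, ← sum_add_distrib, addChar_map_sum]
  simp_rw [h]
  rw [← Fintype.prod_sum (fun i t => ψ (u * t ^ 2 + t * z i))]
  simp_rw [sum_addChar_quad h2 hu]
  rw [prod_mul_distrib, ← addChar_map_sum, sqNorm, mul_sum]
  simp only [prod_const, card_univ, Fintype.card_fin]
  congr 2
  refine sum_congr rfl fun i _ => ?_
  rw [div_eq_mul_inv]; ring

/-- Expand `fourierMass` over pairs x, y; the sum over m is then a d-dimensional Gauss sum at x - y.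
-/
theorem quadSum_pow_mul_distSum {d : ℕ} {ψ : AddChar F ℂ} (h2 : (2 : F) ≠ 0) {u : F}
    (hu : u ≠ 0) (E : Finset (Fin d → F)) :
    quadSum ψ u ^ d * distSum ψ E (-(4 * u)⁻¹) = dualSum ψ E u := by
  unfold distSum dualSum
  simp_rw [fourierMass_eq, mul_sum]
  rw [sum_comm (s := univ)]
  refine sum_congr rfl fun x _ => ?_
  rw [sum_comm (s := univ)]
  refine sum_congr rfl fun y _ => ?_
  rw [← sum_addChar_sqNorm h2 hu]
  exact sum_congr rfl fun m _ => AddChar.map_add_eq_mul _ _ _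

theorem quadSum_mul_conj {ψ : AddChar F ℂ} (hψ : ψ.IsPrimitive) (h2 : (2 : F) ≠ 0) {u : F}
    (hu : u ≠ 0) : quadSum ψ u * conj (quadSum ψ u) = Fintype.card F := by
  classical
  -- Since (a + c)² - a² = 2ac + c², orthogonality in a leaves only c = 0.
  have h : ∀ c : F, ∑ a, ψ (u * (a + c) ^ 2) * conj (ψ (u * a ^ 2)) =
      ψ (u * c ^ 2) * if c = 0 then (Fintype.card F : ℂ) else 0 := by
    intro c
    have : (c = 0) ↔ 2 * u * c = 0 := by simp [h2, hu]
    rw [if_congr this rfl rfl, ← sum_addChar_mul hψ, mul_sum]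
    refine sum_congr rfl fun a _ => ?_
    rw [← AddChar.map_neg_eq_conj, ← AddChar.map_add_eq_mul, ← AddChar.map_add_eq_mul]
    congr 1; ring
  unfold quadSum
  rw [map_sum, sum_mul_sum, sum_comm]
  have h' : ∀ a : F, ∑ b, ψ (u * b ^ 2) * conj (ψ (u * a ^ 2)) =
      ∑ c, ψ (u * (a + c) ^ 2) * conj (ψ (u * a ^ 2)) := fun a =>
    (Equiv.sum_comp (Equiv.addLeft a) fun b => ψ (u * b ^ 2) * conj (ψ (u * a ^ 2))).symm
  simp_rw [h']
  rw [sum_comm]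
  simp_rw [h]
  simp

theorem quadSum_mul_sq (ψ : AddChar F ℂ) (u : F) {a : F} (ha : a ≠ 0) :
    quadSum ψ (u * a ^ 2) = quadSum ψ u := by
  unfold quadSum
  rw [← Equiv.sum_comp (Equiv.mulLeft₀ a ha) fun t => ψ (u * t ^ 2)]
  refine sum_congr rfl fun t _ => ?_
  simp only [Equiv.mulLeft₀_apply]
  congr 1; ring

/-- An element a has χ(a) + 1 square roots, χ being the quadratic character; the constant 1
contributes a full character sum, which vanishes. -/
theorem quadSum_eq [DecidableEq F] {ψ : AddChar F ℂ} (hψ : ψ.IsPrimitive)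
    (hF : ringChar F ≠ 2) {u : F} (hu : u ≠ 0) :
    quadSum ψ u = ∑ a, (quadraticChar F a : ℂ) * ψ (u * a) := by
  have h : ∀ a : F, ∑ t with t ^ 2 = a, ψ (u * t ^ 2) =
      ((quadraticChar F a : ℂ) + 1) * ψ (u * a) := by
    intro a
    rw [sum_congr rfl (g := fun _ => ψ (u * a)) (fun t ht => by rw [(mem_filter.1 ht).2])]
    rw [sum_const, nsmul_eq_mul]
    congr 1
    have := quadraticChar_card_sqrts hF a
    rw [Set.toFinset_ofPred] at this
    exact_mod_cast congrArg (Int.cast (R := ℂ)) this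
  unfold quadSum
  rw [← sum_fiberwise univ (fun t => t ^ 2) fun t => ψ (u * t ^ 2)]
  simp_rw [h, add_mul, one_mul, sum_add_distrib]
  simp_rw [mul_comm u, sum_addChar_mul hψ]
  simp [hu]

theorem quadSum_eq_or_neg {ψ : AddChar F ℂ} (hψ : ψ.IsPrimitive) (hF : ringChar F ≠ 2)
    {u c : F} (hu : u ≠ 0) (hc : c ≠ 0) :
    quadSum ψ (c * u) = quadSum ψ u ∨ quadSum ψ (c * u) = -quadSum ψ u := by
  classical
  have h : quadSum ψ u = (quadraticChar F c : ℂ) * quadSum ψ (c * u) := by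
    rw [quadSum_eq hψ hF hu, quadSum_eq hψ hF (mul_ne_zero hc hu), mul_sum,
      ← Equiv.sum_comp (Equiv.mulLeft₀ c hc)]
    refine sum_congr rfl fun a _ => ?_
    simp only [Equiv.mulLeft₀_apply, map_mul, Int.cast_mul, mul_assoc]
    congr 3; ring_nf
  rcases quadraticChar_dichotomy hc with h1 | h1 <;> rw [h1] at h
  · left; simpa using h.symm
  · right; rw [h]; simp

theorem quadSum_sq {ψ : AddChar F ℂ} (hψ : ψ.IsPrimitive) (hF : ringChar F ≠ 2)
    {u : F} (hu : u ≠ 0) : quadSum ψ u ^ 2 = quadSum ψ 1 ^ 2 := by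
  have := quadSum_eq_or_neg hψ hF one_ne_zero hu
  rw [mul_one] at this
  rcases this with h | h <;> rw [h]
  ring

theorem conj_quadSum_sq {ψ : AddChar F ℂ} (hψ : ψ.IsPrimitive) (hF : ringChar F ≠ 2)
    {u : F} (hu : u ≠ 0) : conj (quadSum ψ u) ^ 2 = conj (quadSum ψ 1) ^ 2 := by
  rw [← map_pow, quadSum_sq hψ hF hu, map_pow]

theorem dualSum_zero {d : ℕ} {ψ : AddChar F ℂ} (hψ : ψ.IsPrimitive)
    (E : Finset (Fin d → F)) :
    dualSum ψ E 0 = (Fintype.card F : ℂ) ^ d * E.card := by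
  have := congrArg (Complex.ofReal) (sum_fourierMass hψ E)
  push_cast at this
  simpa [dualSum] using this

theorem sum_comp_neg_inv_four_mul (h2 : (2 : F) ≠ 0) (φ : F → ℂ) :
    ∑ s, φ s = ∑ u, φ (-(4 * u)⁻¹) :=
  (Equiv.sum_comp (involutive_neg_inv_four_mul h2).toPerm φ).symm

theorem card_pow_mul_distSum {d : ℕ} {ψ : AddChar F ℂ} (hψ : ψ.IsPrimitive) (h2 : (2 : F) ≠ 0)
    {u : F} (hu : u ≠ 0) (E : Finset (Fin d → F)) :
    (Fintype.card F : ℂ) ^ d * distSum ψ E (-(4 * u)⁻¹) =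
      conj (quadSum ψ u) ^ d * dualSum ψ E u := by
  rw [← quadSum_pow_mul_distSum h2 hu, ← quadSum_mul_conj hψ h2 hu, mul_pow]
  ring

/-- Scaling the argument by r multiplies the Gauss sum by χ(r) = ±1, and the sign disappears when d
is even or r is a square. This is where that alternative enters the argument. -/
theorem quadSum_mul_conj_pow {ψ : AddChar F ℂ} (hψ : ψ.IsPrimitive) (h2 : (2 : F) ≠ 0)
    (hF : ringChar F ≠ 2) {d : ℕ} {r : F} (hr : r ≠ 0) (h : Even d ∨ IsSquare r) {u : F}
    (hu : u ≠ 0) :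
    (quadSum ψ (r * u) * conj (quadSum ψ u)) ^ d = (Fintype.card F : ℂ) ^ d := by
  rcases h with h | ⟨a, rfl⟩
  · rcases quadSum_eq_or_neg hψ hF hu hr with h' | h' <;> rw [h']
    · rw [quadSum_mul_conj hψ h2 hu]
    · rw [neg_mul, h.neg_pow, quadSum_mul_conj hψ h2 hu]
  · have ha : a ≠ 0 := fun h => hr (by simp [h])
    rw [← sq, mul_comm _ u, quadSum_mul_sq ψ u ha, quadSum_mul_conj hψ h2 hu]

theorem norm_quadSum_sq {ψ : AddChar F ℂ} (hψ : ψ.IsPrimitive) (h2 : (2 : F) ≠ 0) :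
    ‖conj (quadSum ψ 1) ^ 2‖ = Fintype.card F := by
  have := congrArg norm (quadSum_mul_conj hψ h2 one_ne_zero)
  rw [norm_mul, Complex.norm_conj, Complex.norm_natCast] at this
  rw [norm_pow, Complex.norm_conj, sq, this]

end CharacterSums

/-! ### Bounds for the counts of ratios and of zero distances. -/

section Counting

open Finset ComplexConjugate

variable {F : Type*} [Field F] [DecidableEq F]

/-- The number of pairs in `E` with `‖x - y‖ = 0`. -/
noncomputable def zeroCount {d : ℕ} (E : Finset (Fin d → F)) : ℝ :=
  ∑ p ∈ E ×ˢ E, if sqNorm (p.1 - p.2) = 0 then 1 else 0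

/-- The number of pairs of pairs in `E` with dilation ratio `r`, degenerate ones included. -/
noncomputable def ratioCount {d : ℕ} (E : Finset (Fin d → F)) (r : F) : ℝ :=
  ∑ p ∈ E ×ˢ E, ∑ p' ∈ E ×ˢ E,
    if r * sqNorm (p.1 - p.2) = sqNorm (p'.1 - p'.2) then 1 else 0

theorem zeroCount_nonneg {d : ℕ} (E : Finset (Fin d → F)) : 0 ≤ zeroCount E :=
  sum_nonneg fun _ _ => by split_ifs <;> norm_num

variable [Fintype F]

/-- The total `fourierMass` on the isotropic cone. -/
noncomputable def isotropicMass {d : ℕ} (ψ : AddChar F ℂ) (E : Finset (Fin d → F)) : ℝ :=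
  ∑ m, if sqNorm m = 0 then fourierMass ψ E m else 0

theorem isotropicMass_nonneg {d : ℕ} (ψ : AddChar F ℂ) (E : Finset (Fin d → F)) :
    0 ≤ isotropicMass ψ E :=
  sum_nonneg fun m _ => by
    split_ifs
    · exact fourierMass_nonneg ψ E m
    · exact le_rfl

theorem isotropicMass_le {d : ℕ} {ψ : AddChar F ℂ} (hψ : ψ.IsPrimitive)
    (E : Finset (Fin d → F)) :
    isotropicMass ψ E ≤ (Fintype.card F : ℝ) ^ d * E.card := by
  rw [← sum_fourierMass hψ]
  refine sum_le_sum fun m _ => ?_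
  split_ifs
  · exact le_rfl
  · exact fourierMass_nonneg ψ E m

/-- Parseval's identity for two weighted exponential sums. -/
theorem sum_expSum_mul_conj {ι κ : Type*} {ψ : AddChar F ℂ} (hψ : ψ.IsPrimitive)
    (S : Finset ι) (T : Finset κ) (a : ι → ℝ) (b : κ → ℝ) (f : ι → F) (g : κ → F) :
    ∑ s, (∑ i ∈ S, ψ (s * f i) * (a i : ℂ)) * conj (∑ j ∈ T, ψ (s * g j) * (b j : ℂ)) =
      (Fintype.card F : ℂ) *
        ((∑ i ∈ S, ∑ j ∈ T, if f i = g j then a i * b j else 0 : ℝ) : ℂ) := by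
  simp_rw [map_sum, sum_mul_sum]
  rw [sum_comm]
  push_cast
  rw [mul_sum]
  refine sum_congr rfl fun i _ => ?_
  rw [sum_comm, mul_sum]
  refine sum_congr rfl fun j _ => ?_
  have h : ∀ s : F, ψ (s * f i) * (a i : ℂ) * conj (ψ (s * g j) * (b j : ℂ)) =
      (a i * b j : ℂ) * ψ (s * (f i - g j)) := fun s => by
    rw [map_mul (starRingEnd ℂ), Complex.conj_ofReal, ← AddChar.map_neg_eq_conj, mul_sub, sub_eq_add_neg,
      AddChar.map_add_eq_mul]
    ring
  simp_rw [h, ← mul_sum, sum_addChar_mul hψ, sub_eq_zero]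
  split_ifs <;> push_cast <;> ring


theorem sum_distSum_mul_conj {d : ℕ} {ψ : AddChar F ℂ} (hψ : ψ.IsPrimitive)
    (E : Finset (Fin d → F)) (r : F) :
    ∑ s, distSum ψ E (r * s) * conj (distSum ψ E s) =
      (Fintype.card F : ℂ) * (ratioCount E r : ℂ) := by
  have := sum_expSum_mul_conj hψ (E ×ˢ E) (E ×ˢ E) (fun _ => 1) (fun _ => 1)
    (fun p => r * sqNorm (p.1 - p.2)) (fun p => sqNorm (p.1 - p.2))
  simp only [mul_one] at this
  rw [ratioCount, ← this]
  refine sum_congr rfl fun s _ => ?_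
  rw [distSum_eq, distSum_eq]
  simp only [mul_left_comm s r, mul_assoc, Complex.ofReal_one, mul_one]

theorem sum_distSum {d : ℕ} {ψ : AddChar F ℂ} (hψ : ψ.IsPrimitive)
    (E : Finset (Fin d → F)) :
    ∑ s, distSum ψ E s = (Fintype.card F : ℂ) * (zeroCount E : ℂ) := by
  have := sum_expSum_mul_conj hψ (E ×ˢ E) {()} (fun _ => 1) (fun _ => 1)
    (fun p => sqNorm (p.1 - p.2)) (fun _ => 0)
  simpa [zeroCount, distSum_eq] using this

theorem sum_dualSum {d : ℕ} {ψ : AddChar F ℂ} (hψ : ψ.IsPrimitive)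
    (E : Finset (Fin d → F)) :
    ∑ u, dualSum ψ E u = (Fintype.card F : ℂ) * (isotropicMass ψ E : ℂ) := by
  have := sum_expSum_mul_conj hψ univ {()} (fourierMass ψ E) (fun _ => 1) sqNorm (fun _ => 0)
  simpa [isotropicMass, dualSum] using this

theorem sum_dualSum_mul_conj_quadSum {d : ℕ} {ψ : AddChar F ℂ} (hψ : ψ.IsPrimitive)
    (E : Finset (Fin d → F)) :
    ∑ u, dualSum ψ E u * conj (quadSum ψ u) =
      (Fintype.card F : ℂ) *
        ((∑ m, ∑ t : F, if sqNorm m = t ^ 2 then fourierMass ψ E m else 0 : ℝ) : ℂ) := by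
  have := sum_expSum_mul_conj hψ univ univ (fourierMass ψ E) (fun _ => 1) sqNorm
    (fun t => t ^ 2)
  simpa [quadSum, dualSum] using this

/-- B is the weighted number of pairs with r‖m‖ = ‖m'‖. Pairs with both m and m' isotropic always
qualify and contribute the squared cone mass; all other terms are nonnegative. -/
theorem sum_dualSum_mul_conj {d : ℕ} {ψ : AddChar F ℂ} (hψ : ψ.IsPrimitive)
    (E : Finset (Fin d → F)) (r : F) :
    ∃ B : ℝ, isotropicMass ψ E ^ 2 ≤ B ∧
      ∑ u, dualSum ψ E (r * u) * conj (dualSum ψ E u) = (Fintype.card F : ℂ) * (B : ℂ) := by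
  refine ⟨∑ m, ∑ m', if r * sqNorm m = sqNorm m' then fourierMass ψ E m * fourierMass ψ E m'
    else 0, ?_, ?_⟩
  rotate_left
  · have := sum_expSum_mul_conj hψ univ univ (fourierMass ψ E) (fourierMass ψ E)
      (fun m => r * sqNorm m) sqNorm
    rw [← this]
    refine sum_congr rfl fun s _ => ?_
    simp only [dualSum, mul_left_comm s r, mul_assoc]
  · rw [isotropicMass, sq, sum_mul_sum]
    refine sum_le_sum fun m _ => sum_le_sum fun m' _ => ?_
    have := mul_nonneg (fourierMass_nonneg ψ E m) (fourierMass_nonneg ψ E m')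
    by_cases h : sqNorm m = 0 <;> by_cases h' : sqNorm m' = 0 <;> simp [h, h']
    all_goals split_ifs <;> linarith

theorem ratioCount_ge {d : ℕ} {ψ : AddChar F ℂ} (hψ : ψ.IsPrimitive) (h2 : (2 : F) ≠ 0)
    (hF : ringChar F ≠ 2) {r : F} (hr : r ≠ 0) (h : Even d ∨ IsSquare r)
    (E : Finset (Fin d → F)) :
    (Fintype.card F : ℝ) ^ d * (E.card : ℝ) ^ 4 + Fintype.card F * isotropicMass ψ E ^ 2
        - ((Fintype.card F : ℝ) ^ d * E.card) ^ 2 ≤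
      (Fintype.card F : ℝ) ^ d * (Fintype.card F * ratioCount E r) := by
  have hr' : r⁻¹ ≠ 0 := inv_ne_zero hr
  have h' : Even d ∨ IsSquare r⁻¹ := h.imp_right IsSquare.inv
  have hq : (Fintype.card F : ℂ) ≠ 0 := by simp
  obtain ⟨B, hB, hsum⟩ := sum_dualSum_mul_conj hψ E r⁻¹
  -- Duality fails at u = 0, so the last term is the difference there between the true value and the
  -- dual expression.
  have key : ∀ u : F, (Fintype.card F : ℂ) ^ d *
      (distSum ψ E (r * -(4 * u)⁻¹) * conj (distSum ψ E (-(4 * u)⁻¹))) =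
      dualSum ψ E (r⁻¹ * u) * conj (dualSum ψ E u) +
        if u = 0 then (Fintype.card F : ℂ) ^ d * (E.card : ℂ) ^ 4 -
          ((Fintype.card F : ℂ) ^ d * E.card) ^ 2 else 0 := by
    intro u
    split_ifs with hu
    · subst hu
      simp only [mul_zero, inv_zero, neg_zero, distSum_zero, dualSum_zero hψ, map_mul, map_pow,
        Complex.conj_natCast]
      ring
    · have e : r * -(4 * u)⁻¹ = -(4 * (r⁻¹ * u))⁻¹ := by
        simp only [mul_inv, inv_inv]; ring
      rw [e, ← quadSum_pow_mul_distSum h2 hu, ← quadSum_pow_mul_distSum h2 (mul_ne_zero hr' hu),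
        ← quadSum_mul_conj_pow hψ h2 hF hr' h' hu, map_mul, map_pow, mul_pow, add_zero]
      ring
  have total : (Fintype.card F : ℂ) ^ d * (Fintype.card F * ratioCount E r) =
      Fintype.card F * B + ((Fintype.card F : ℂ) ^ d * (E.card : ℂ) ^ 4 -
          ((Fintype.card F : ℂ) ^ d * E.card) ^ 2) := by
    rw [← sum_distSum_mul_conj hψ, sum_comp_neg_inv_four_mul h2, mul_sum]
    simp_rw [key]
    rw [sum_add_distrib, hsum]
    simp
  have total' : (Fintype.card F : ℝ) ^ d * (Fintype.card F * ratioCount E r) =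
      Fintype.card F * B + ((Fintype.card F : ℝ) ^ d * (E.card : ℝ) ^ 4 -
          ((Fintype.card F : ℝ) ^ d * E.card) ^ 2) := by exact_mod_cast total
  have := mul_le_mul_of_nonneg_left hB (Nat.cast_nonneg (α := ℝ) (Fintype.card F))
  linarith

/-- The square of a Gauss sum does not depend on u ≠ 0, so its d-th power is a constant of modulus
q^n. What remains is the sum of `dualSum`, which detects the isotropic cone. -/
theorem zeroCount_le_of_even {d n : ℕ} (hd : d = 2 * n) {ψ : AddChar F ℂ}
    (hψ : ψ.IsPrimitive) (h2 : (2 : F) ≠ 0) (hF : ringChar F ≠ 2) (E : Finset (Fin d → F)) :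
    (Fintype.card F : ℝ) ^ d * (Fintype.card F * zeroCount E) ≤
      (Fintype.card F : ℝ) ^ d * (E.card : ℝ) ^ 2 +
        (Fintype.card F : ℝ) ^ n * (Fintype.card F * isotropicMass ψ E +
          (Fintype.card F : ℝ) ^ d * E.card) := by
  set g := conj (quadSum ψ 1) ^ 2 with hg
  have key : ∀ u : F, (Fintype.card F : ℂ) ^ d * distSum ψ E (-(4 * u)⁻¹) =
      g ^ n * dualSum ψ E u + if u = 0 then (Fintype.card F : ℂ) ^ d * (E.card : ℂ) ^ 2 -
        g ^ n * ((Fintype.card F : ℂ) ^ d * E.card) else 0 := by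
    intro u
    split_ifs with hu
    · subst hu
      simp only [mul_zero, inv_zero, neg_zero, distSum_zero, dualSum_zero hψ]
      ring
    · rw [card_pow_mul_distSum hψ h2 hu, hg, ← conj_quadSum_sq hψ hF hu, ← pow_mul, ← hd, add_zero]
  have total : (((Fintype.card F : ℝ) ^ d * (Fintype.card F * zeroCount E) : ℝ) : ℂ) =
      (Fintype.card F : ℂ) ^ d * (E.card : ℂ) ^ 2 +
      g ^ n * (Fintype.card F * (isotropicMass ψ E : ℂ) -
        ((Fintype.card F : ℂ) ^ d * E.card)) := by
    push_cast
    rw [← sum_distSum hψ, sum_comp_neg_inv_four_mul h2, mul_sum]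
    simp_rw [key]
    rw [sum_add_distrib, ← mul_sum, sum_dualSum hψ]
    simp
    ring
  have hn := congrArg norm total
  rw [Complex.norm_real, Real.norm_of_nonneg (by have := zeroCount_nonneg E; positivity)] at hn
  rw [hn]
  refine (norm_add_le _ _).trans (add_le_add (by simp) ?_)
  rw [norm_mul, norm_pow, norm_quadSum_sq hψ h2]
  refine mul_le_mul_of_nonneg_left ((norm_sub_le _ _).trans ?_) (by positivity)
  simp [abs_of_nonneg (isotropicMass_nonneg ψ E)]

theorem abs_card_sqrts_sub_one_le (hF : ringChar F ≠ 2) (a : F) :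
    |(∑ t : F, if a = t ^ 2 then (1 : ℝ) else 0) - 1| ≤ 1 := by
  have h := quadraticChar_card_sqrts hF a
  rw [Set.toFinset_ofPred] at h
  have h' : (∑ t : F, if a = t ^ 2 then (1 : ℝ) else 0) = (quadraticChar F a : ℝ) + 1 := by
    rw [sum_boole]
    simp_rw [eq_comm (a := a)]
    exact_mod_cast congrArg (Int.cast (R := ℝ)) h
  rw [h', add_sub_cancel_right]
  by_cases ha : a = 0
  · simp [ha]
  · rcases quadraticChar_dichotomy ha with h1 | h1 <;> simp [h1]

/-- One Gauss sum is left over after pairing. Summed against `dualSum` it counts square roots of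
‖m‖, and the u = 0 correction subtracts 1 from that count. The weights are thus values of the
quadratic character, so the total mass bounds the error. -/
theorem zeroCount_le_of_odd {d n : ℕ} (hd : d = 2 * n + 1) {ψ : AddChar F ℂ}
    (hψ : ψ.IsPrimitive) (h2 : (2 : F) ≠ 0) (hF : ringChar F ≠ 2) (E : Finset (Fin d → F)) :
    (Fintype.card F : ℝ) ^ d * (Fintype.card F * zeroCount E) ≤
      (Fintype.card F : ℝ) ^ d * (E.card : ℝ) ^ 2 +
        (Fintype.card F : ℝ) ^ n * (Fintype.card F * ((Fintype.card F : ℝ) ^ d * E.card)) := by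
  set g := conj (quadSum ψ 1) ^ 2 with hg
  have hG0 : quadSum ψ 0 = Fintype.card F := by simp [quadSum]
  set D : ℝ := ∑ m, fourierMass ψ E m * ((∑ t : F, if sqNorm m = t ^ 2 then (1 : ℝ) else 0) - 1)
    with hD
  have hD' : D = (∑ m, ∑ t : F, if sqNorm m = t ^ 2 then fourierMass ψ E m else 0) -
      (Fintype.card F : ℝ) ^ d * E.card := by
    rw [hD, ← sum_fourierMass hψ, ← sum_sub_distrib]
    refine sum_congr rfl fun m _ => ?_
    rw [mul_sub, mul_one, mul_sum]
    simp only [mul_ite, mul_one, mul_zero]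
  have hDle : |D| ≤ (Fintype.card F : ℝ) ^ d * E.card := by
    rw [← sum_fourierMass hψ]
    refine (abs_sum_le_sum_abs _ _).trans (sum_le_sum fun m _ => ?_)
    rw [abs_mul, abs_of_nonneg (fourierMass_nonneg ψ E m)]
    exact mul_le_of_le_one_right (fourierMass_nonneg ψ E m) (abs_card_sqrts_sub_one_le hF _)
  have key : ∀ u : F, (Fintype.card F : ℂ) ^ d * distSum ψ E (-(4 * u)⁻¹) =
      g ^ n * (dualSum ψ E u * conj (quadSum ψ u)) +
        if u = 0 then (Fintype.card F : ℂ) ^ d * (E.card : ℂ) ^ 2 -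
        g ^ n * (Fintype.card F * ((Fintype.card F : ℂ) ^ d * E.card)) else 0 := by
    intro u
    split_ifs with hu
    · subst hu
      simp only [mul_zero, inv_zero, neg_zero, distSum_zero, dualSum_zero hψ, hG0,
        Complex.conj_natCast]
      ring
    · have hpow : conj (quadSum ψ u) ^ d = conj (quadSum ψ u) ^ (2 * n) * conj (quadSum ψ u) := by
        rw [← pow_succ, ← hd]
      rw [card_pow_mul_distSum hψ h2 hu, hg, ← conj_quadSum_sq hψ hF hu, hpow, ← pow_mul]
      ring
  have total : (((Fintype.card F : ℝ) ^ d * (Fintype.card F * zeroCount E) : ℝ) : ℂ) =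
      (Fintype.card F : ℂ) ^ d * (E.card : ℂ) ^ 2 + g ^ n * (Fintype.card F * (D : ℂ)) := by
    rw [hD']
    push_cast
    rw [← sum_distSum hψ, sum_comp_neg_inv_four_mul h2, mul_sum]
    simp_rw [key]
    rw [sum_add_distrib, ← mul_sum, sum_dualSum_mul_conj_quadSum hψ]
    simp
    ring
  have hn := congrArg norm total
  rw [Complex.norm_real, Real.norm_of_nonneg (by have := zeroCount_nonneg E; positivity)] at hn
  rw [hn]
  refine (norm_add_le _ _).trans (add_le_add (by simp) ?_)
  rw [norm_mul, norm_pow, norm_quadSum_sq hψ h2]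
  refine mul_le_mul_of_nonneg_left ?_ (by positivity)
  rw [norm_mul, Complex.norm_natCast, Complex.norm_real, Real.norm_eq_abs]
  gcongr

end Counting

/-! ### Greedy paths in the dilation graph. -/

section Graph

open Finset

/-- A finite graph with `m` vertices and more than `c * m` edges has a nonempty induced subgraph
of minimum degree at least `c`. -/
theorem exists_subset_min_degree {α : Type*} [DecidableEq α] (adj : α → α → Prop)
    [DecidableRel adj] (hsymm : ∀ a b, adj a b → adj b a) (hirr : ∀ a, ¬ adj a a) (c : ℕ)
    (V : Finset α) (h : 2 * c * #V < ∑ a ∈ V, ∑ b ∈ V, if adj a b then 1 else 0) :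
    ∃ W ⊆ V, W.Nonempty ∧ ∀ a ∈ W, c ≤ #{b ∈ W | adj a b} := by
  induction V using Finset.strongInduction with
  | H V ih =>
    by_cases hV : ∀ a ∈ V, c ≤ #{b ∈ V | adj a b}
    · refine ⟨V, subset_rfl, ?_, hV⟩
      rw [nonempty_iff_ne_empty]
      rintro rfl
      simp at h
    -- Deleting a vertex of degree below c lowers the double count of edges by less than 2c, so the
    -- hypothesis survives.
    · push Not at hV
      obtain ⟨a, ha, hac⟩ := hV
      rw [card_filter] at hac
      have hcard : #V = #(V.erase a) + 1 := (card_erase_add_one ha).symm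
      have hcomm : ∑ b ∈ V.erase a, (if adj b a then 1 else 0) =
          ∑ b ∈ V.erase a, if adj a b then 1 else 0 :=
        sum_congr rfl fun b _ => if_congr ⟨hsymm b a, hsymm a b⟩ rfl rfl
      have hsplit : ∑ x ∈ V, ∑ b ∈ V, (if adj x b then 1 else 0) =
          ∑ b ∈ V, (if adj a b then 1 else 0) +
            (∑ b ∈ V.erase a, (if adj a b then 1 else 0) +
              ∑ x ∈ V.erase a, ∑ b ∈ V.erase a, if adj x b then 1 else 0) := by
        rw [← add_sum_erase V _ ha, ← hcomm, ← sum_add_distrib]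
        congr 1
        exact sum_congr rfl fun x _ => (add_sum_erase V _ ha).symm
      have hdeg : ∑ b ∈ V, (if adj a b then 1 else 0) =
          ∑ b ∈ V.erase a, if adj a b then 1 else 0 := by
        rw [← add_sum_erase V _ ha, if_neg (hirr a), zero_add]
      obtain ⟨W, hW, hW'⟩ := ih (V.erase a) (erase_ssubset ha) (by
        rw [hsplit, hcard] at h
        rw [hdeg] at hac h
        rw [mul_add] at h
        omega)
      exact ⟨W, hW.trans (erase_subset a V), hW'⟩

variable {F : Type*} [Field F]

/-- Two pairs `(x, y)`, `(x', y')` are adjacent if `‖y - y'‖ = r ‖x - x'‖ ≠ 0`. -/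
def dilationAdj {d : ℕ} (r : F) (p p' : (Fin d → F) × (Fin d → F)) : Prop :=
  sqNorm (p.2 - p'.2) = r * sqNorm (p.1 - p'.1) ∧ r * sqNorm (p.1 - p'.1) ≠ 0

theorem sqNorm_sub_comm {d : ℕ} (x y : Fin d → F) : sqNorm (x - y) = sqNorm (y - x) := by
  unfold sqNorm
  refine sum_congr rfl fun i _ => ?_
  simp only [Pi.sub_apply]
  ring

theorem dilationAdj.symm {d : ℕ} {r : F} {p p' : (Fin d → F) × (Fin d → F)}
    (h : dilationAdj r p p') : dilationAdj r p' p := by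
  unfold dilationAdj at *
  rwa [sqNorm_sub_comm, sqNorm_sub_comm p'.1]

theorem dilationAdj.fst_ne {d : ℕ} {r : F} {p p' : (Fin d → F) × (Fin d → F)}
    (h : dilationAdj r p p') : p'.1 ≠ p.1 := by
  intro he
  refine h.2 ?_
  rw [he, sub_self, sqNorm_zero, mul_zero]

theorem dilationAdj.snd_ne {d : ℕ} {r : F} {p p' : (Fin d → F) × (Fin d → F)}
    (h : dilationAdj r p p') : p'.2 ≠ p.2 := by
  intro he
  refine h.2 ?_
  rw [← h.1, he, sub_self, sqNorm_zero]

/-- Neighbours sharing a coordinate with P lie in a union of two products, of total size at most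
2k|E|. -/
theorem exists_dilationAdj_avoiding [DecidableEq F] {d k : ℕ} {r : F} {E : Finset (Fin d → F)}
    {W : Finset ((Fin d → F) × (Fin d → F))} (hW : W ⊆ E ×ˢ E)
    [DecidableRel (dilationAdj (d := d) r)] {p : (Fin d → F) × (Fin d → F)}
    (hdeg : 2 * k * #E < #{b ∈ W | dilationAdj r p b})
    (P : Finset ((Fin d → F) × (Fin d → F))) (hP : #P ≤ k) :
    ∃ p' ∈ W, dilationAdj r p p' ∧ ∀ b ∈ P, p'.1 ≠ b.1 ∧ p'.2 ≠ b.2 := by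
  by_contra! hno
  have hsub : ({b ∈ W | dilationAdj r p b} : Finset _) ⊆
      P.image Prod.fst ×ˢ E ∪ E ×ˢ P.image Prod.snd := by
    intro b hb
    obtain ⟨hbW, hb⟩ := mem_filter.1 hb
    obtain ⟨c, hc, hbc⟩ := hno b hbW hb
    have hE := mem_product.1 (hW hbW)
    rw [mem_union, mem_product, mem_product]
    by_cases h1 : b.1 = c.1
    · exact Or.inl ⟨mem_image.2 ⟨c, hc, h1.symm⟩, hE.2⟩
    · exact Or.inr ⟨hE.1, mem_image.2 ⟨c, hc, (hbc h1).symm⟩⟩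
  have h1 := (card_le_card hsub).trans (card_union_le _ _)
  rw [card_product, card_product] at h1
  have h2 : #(P.image Prod.fst) * #E ≤ k * #E :=
    Nat.mul_le_mul_right _ (card_image_le.trans hP)
  have h3 : #E * #(P.image Prod.snd) ≤ #E * k :=
    Nat.mul_le_mul_left _ (card_image_le.trans hP)
  have : #E * k = k * #E := mul_comm _ _
  have : 2 * k * #E = 2 * (k * #E) := mul_assoc _ _ _
  omega

/-- Adjacency already separates consecutive vertices in both coordinates, so each new vertex has at
most three others to avoid. -/
theorem containsPair_of_min_degree [DecidableEq F] {d : ℕ} {r : F} {E : Finset (Fin d → F)}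
    {W : Finset ((Fin d → F) × (Fin d → F))} (hW : W ⊆ E ×ˢ E) (hne : W.Nonempty)
    [DecidableRel (dilationAdj (d := d) r)]
    (hdeg : ∀ p ∈ W, 2 * 3 * #E < #{b ∈ W | dilationAdj r p b}) :
    ContainsPair (kPath 4) E r := by
  obtain ⟨a, ha⟩ := hne
  obtain ⟨b, hb, hab, -⟩ := exists_dilationAdj_avoiding hW (hdeg a ha) ∅ (by simp)
  obtain ⟨c, hc, hbc, hc'⟩ := exists_dilationAdj_avoiding hW (hdeg b hb) {a} (by simp)
  obtain ⟨e, he, hce, he'⟩ := exists_dilationAdj_avoiding hW (hdeg c hc) {a, b}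
    (card_le_two.trans (by norm_num))
  obtain ⟨f, hf, hef, hf'⟩ := exists_dilationAdj_avoiding hW (hdeg e he) {a, b, c}
    card_le_three
  simp only [mem_singleton, mem_insert, forall_eq_or_imp, forall_eq] at hc' he' hf'
  have mem : ∀ p ∈ W, p.1 ∈ E ∧ p.2 ∈ E := fun p hp => mem_product.1 (hW hp)
  have n1 := hab.fst_ne
  have n2 := hbc.fst_ne
  have n3 := hce.fst_ne
  have n4 := hef.fst_ne
  have m1 := hab.snd_ne
  have m2 := hbc.snd_ne
  have m3 := hce.snd_ne
  have m4 := hef.snd_ne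
  refine ⟨![a.1, b.1, c.1, e.1, f.1], ![a.2, b.2, c.2, e.2, f.2], ?_, ?_, ?_, ?_, ?_⟩
  · intro i j hij
    fin_cases i <;> fin_cases j <;> simp at hij ⊢ <;> grind
  · intro i j hij
    fin_cases i <;> fin_cases j <;> simp at hij ⊢ <;> grind
  · intro i
    fin_cases i
    exacts [(mem a ha).1, (mem b hb).1, (mem c hc).1, (mem e he).1, (mem f hf).1]
  · intro i
    fin_cases i
    exacts [(mem a ha).2, (mem b hb).2, (mem c hc).2, (mem e he).2, (mem f hf).2]
  · intro i j hij
    rw [kPath, SimpleGraph.pathGraph_adj] at hij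
    fin_cases i <;> fin_cases j <;> simp at hij
    exacts [hab, hab.symm, hbc, hbc.symm, hce, hce.symm, hef, hef.symm]

theorem sum_dilationAdj [DecidableEq F] {d : ℕ} {r : F} (hr : r ≠ 0) (E : Finset (Fin d → F))
    [DecidableRel (dilationAdj (d := d) r)] :
    (∑ p ∈ E ×ˢ E, ∑ p' ∈ E ×ˢ E, if dilationAdj r p p' then (1 : ℝ) else 0) =
      ratioCount E r - zeroCount E ^ 2 := by
  have hsq : zeroCount E ^ 2 = ∑ p ∈ E ×ˢ E, ∑ p' ∈ E ×ˢ E,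
      if sqNorm (p.1 - p.2) = 0 ∧ sqNorm (p'.1 - p'.2) = 0 then (1 : ℝ) else 0 := by
    rw [zeroCount, sq, sum_mul_sum]
    refine sum_congr rfl fun p _ => sum_congr rfl fun p' _ => ?_
    by_cases h : sqNorm (p.1 - p.2) = 0 <;> simp [h]
  rw [hsq, ratioCount, ← sum_sub_distrib]
  simp_rw [← sum_sub_distrib, sum_product]
  refine sum_congr rfl fun x _ => ?_
  -- Regroups a pair of vertices (x, y), (x', y') as the distance pairs (x, x') and (y, y').
  rw [sum_comm]
  refine sum_congr rfl fun x' _ => sum_congr rfl fun y _ => sum_congr rfl fun y' _ => ?_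
  simp only [dilationAdj]
  by_cases h : sqNorm (x - x') = 0 <;> by_cases h' : sqNorm (y - y') = 0 <;>
    simp [h, h', hr, eq_comm]
  exact fun h0 => h' h0.symm

end Graph

/-! ### Numerical estimates and the dimension cases. -/

section Assembly

open Finset

theorem half_pow_le_of_even {q Q A W N f : ℝ} (hq : 3 ≤ q) (hQ : 0 < Q) (hA : 20 * Q ≤ A)
    (hf : 0 ≤ f) (hW : 0 ≤ W) (hWA : W ≤ Q ^ 2 * A)
    (h1 : Q ^ 2 * A ^ 4 + q * W ^ 2 - (Q ^ 2 * A) ^ 2 ≤ Q ^ 2 * (q * N))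
    (h2 : Q ^ 2 * (q * f) ≤ Q ^ 2 * A ^ 2 + Q * (q * W + Q ^ 2 * A)) :
    A ^ 4 / 2 ≤ q * (N - f ^ 2) := by
  -- Rescaling by Q = q^(d/2) gives the cone term the same coefficient q w² in both bounds.
  obtain ⟨w, rfl⟩ : ∃ w, W = Q * w := ⟨W / Q, by field_simp⟩
  have hw : 0 ≤ w := nonneg_of_mul_nonneg_right hW hQ
  have hwA : w ≤ Q * A := by
    refine le_of_mul_le_mul_left ?_ hQ
    linarith
  have hA0 : 0 < A := by linarith
  have hQ2 : 0 < Q ^ 2 := by positivity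
  have h1' : A ^ 4 + q * w ^ 2 - Q ^ 2 * A ^ 2 ≤ q * N := by
    refine le_of_mul_le_mul_left ?_ hQ2
    linarith
  have h2' : q * f ≤ A ^ 2 + Q * A + q * w := by
    refine le_of_mul_le_mul_left ?_ hQ2
    linarith
  set b := A ^ 2 + Q * A with hb
  have hb0 : 0 ≤ b := by positivity
  have hbA : b ≤ 21 / 20 * A ^ 2 := by nlinarith
  have hq0 : 0 < q := by linarith
  have h3 : (q * f) ^ 2 ≤ (b + q * w) ^ 2 := by gcongr
  -- The term q w² cancels the one in `h1'`; the cross term 2bw is small because w ≤ QA ≤ A²/20.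
  have h4 : q * f ^ 2 ≤ b ^ 2 / 3 + 2 * b * w + q * w ^ 2 := by
    refine le_of_mul_le_mul_left ?_ hq0
    nlinarith [mul_nonneg (sub_nonneg.2 hq) (sq_nonneg b)]
  have h5 : b ^ 2 ≤ (21 / 20 * A ^ 2) ^ 2 := by gcongr
  have hQA : Q * A ≤ A ^ 2 / 20 := by nlinarith
  have h6 : b * w ≤ (21 / 20 * A ^ 2) * (A ^ 2 / 20) := by
    gcongr
    linarith
  have h7 : (Q * A) ^ 2 ≤ (A ^ 2 / 20) ^ 2 := by gcongr
  nlinarith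

theorem half_pow_le_of_odd {q Q A W N f : ℝ} (hq : 3 ≤ q) (hQ : 0 < Q) (hA0 : 0 < A)
    (hA : 400 * (q * Q ^ 2) ≤ A ^ 2) (hf : 0 ≤ f)
    (h1 : q * Q ^ 2 * A ^ 4 + q * W ^ 2 - (q * Q ^ 2 * A) ^ 2 ≤ q * Q ^ 2 * (q * N))
    (h2 : q * Q ^ 2 * (q * f) ≤ q * Q ^ 2 * A ^ 2 + Q * (q * (q * Q ^ 2 * A))) :
    A ^ 4 / 2 ≤ q * (N - f ^ 2) := by
  have hq0 : 0 < q := by linarith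
  have hP : 0 < q * Q ^ 2 := by positivity
  have h1' : A ^ 4 - q * Q ^ 2 * A ^ 2 ≤ q * N := by
    refine le_of_mul_le_mul_left ?_ hP
    have : 0 ≤ q * W ^ 2 := by positivity
    linarith
  have h2' : q * f ≤ A ^ 2 + Q * q * A := by
    refine le_of_mul_le_mul_left ?_ hP
    linarith
  -- From 1200 Q² ≤ 400 q Q² ≤ A².
  have hQA : Q ≤ A / 30 := by
    refine le_of_sq_le_sq ?_ (by positivity)
    nlinarith
  have h3 : (q * f) ^ 2 ≤ (A ^ 2 + Q * q * A) ^ 2 := by gcongr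
  have h4 : q * f ^ 2 ≤ A ^ 4 / 3 + 2 * Q * A ^ 3 + q * Q ^ 2 * A ^ 2 := by
    refine le_of_mul_le_mul_left ?_ hq0
    nlinarith [mul_nonneg (sub_nonneg.2 hq) (sq_nonneg (A ^ 2))]
  have h5 : Q * A ^ 3 ≤ A / 30 * A ^ 3 := by gcongr
  have h6 : q * Q ^ 2 * A ^ 2 ≤ A ^ 2 / 400 * A ^ 2 := by
    gcongr
    linarith
  nlinarith

theorem containsPair_of_card_ge {F : Type*} [Field F] [Fintype F] (hq : Odd (Fintype.card F))
    {d : ℕ} {E : Finset (Fin d → F)} {r : F} (hr : r ≠ 0) (h : Even d ∨ IsSquare r)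
    (hE : 400 * (Fintype.card F : ℝ) ^ d ≤ (E.card : ℝ) ^ 2)
    (hE' : 27 * (Fintype.card F : ℝ) ≤ E.card) : ContainsPair (kPath 4) E r := by
  classical
  have hF : ringChar F ≠ 2 := fun h => by
    have := FiniteField.even_card_of_char_two h
    rw [← Nat.even_iff] at this
    exact (Nat.not_even_iff_odd.2 hq) this
  have h2 : (2 : F) ≠ 0 := Ring.two_ne_zero hF
  have hq3 : 3 ≤ Fintype.card F := by
    have := Fintype.one_lt_card (α := F)
    obtain ⟨k, hk⟩ := hq
    omega
  have hq3' : (3 : ℝ) ≤ Fintype.card F := by exact_mod_cast hq3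
  have hψ := AddChar.FiniteField.primitiveChar_to_Complex_isPrimitive F
  set ψ := AddChar.FiniteField.primitiveChar_to_Complex F
  have hA0 : (0 : ℝ) < E.card := by linarith
  have main : (E.card : ℝ) ^ 4 / 2 ≤
      Fintype.card F * (ratioCount E r - zeroCount E ^ 2) := by
    have h1 := ratioCount_ge hψ h2 hF hr h E
    rcases Nat.even_or_odd' d with ⟨n, hd | hd⟩
    · have h3 := zeroCount_le_of_even hd hψ h2 hF E
      have h4 := isotropicMass_le hψ E
      have e : (Fintype.card F : ℝ) ^ d = ((Fintype.card F : ℝ) ^ n) ^ 2 := by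
        rw [hd, ← pow_mul, mul_comm]
      rw [e] at h1 h3 h4 hE
      refine half_pow_le_of_even hq3' (by positivity) ?_ (zeroCount_nonneg E)
        (isotropicMass_nonneg ψ E) h4 h1 h3
      refine le_of_sq_le_sq ?_ hA0.le
      linarith
    · have h3 := zeroCount_le_of_odd hd hψ h2 hF E
      have e : (Fintype.card F : ℝ) ^ d = Fintype.card F * ((Fintype.card F : ℝ) ^ n) ^ 2 := by
        rw [hd, pow_succ, ← pow_mul, mul_comm 2 n, mul_comm]
      rw [e] at h1 h3 hE
      exact half_pow_le_of_odd hq3' (by positivity) hA0 hE (zeroCount_nonneg E) h1 h3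
  -- A minimum degree of 6|E| + 1 is wanted. The edge count is at least |E|⁴/(2q) ≥ 27|E|³/2, which
  -- beats 12|E|³ + 2|E|².
  have hedges : 2 * (6 * E.card + 1) * #(E ×ˢ E) < ∑ p ∈ E ×ˢ E, ∑ p' ∈ E ×ˢ E,
      if dilationAdj r p p' then 1 else 0 := by
    have hsum := sum_dilationAdj hr E
    rw [← hsum] at main
    rw [card_product]
    have hA81 : (81 : ℝ) ≤ E.card := by linarith
    suffices (2 * (6 * (E.card : ℝ) + 1) * (E.card * E.card)) <
        ∑ p ∈ E ×ˢ E, ∑ p' ∈ E ×ˢ E, if dilationAdj r p p' then (1 : ℝ) else 0 by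
      exact_mod_cast this
    refine lt_of_mul_lt_mul_left (lt_of_lt_of_le ?_ main) (by positivity : (0 : ℝ) ≤ Fintype.card F)
    have hc : (0 : ℝ) < (2 * (6 * (E.card : ℝ) + 1) * (E.card * E.card)) := by positivity
    calc (Fintype.card F : ℝ) * (2 * (6 * (E.card : ℝ) + 1) * (E.card * E.card))
        ≤ (E.card / 27) * (2 * (6 * (E.card : ℝ) + 1) * (E.card * E.card)) := by
          gcongr
          linarith
      _ < (E.card : ℝ) ^ 4 / 2 := by
          have : (0 : ℝ) < (E.card : ℝ) ^ 3 := by positivity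
          nlinarith
  obtain ⟨W, hW, hne, hdeg⟩ := exists_subset_min_degree (dilationAdj r)
    (fun _ _ h => h.symm) (fun _ h => h.fst_ne rfl) _ _ hedges
  exact containsPair_of_min_degree hW hne fun p hp => by
    have := hdeg p hp
    omega

theorem rpow_div_pow {q : ℝ} (hq : 0 ≤ q) (a : ℝ) {k n : ℕ} (hk : k ≠ 0) (ha : a = n) :
    (q ^ (a / k)) ^ k = q ^ n := by
  rw [← Real.rpow_natCast, ← Real.rpow_mul hq, div_mul_cancel₀ _ (by exact_mod_cast hk), ha,
    Real.rpow_natCast]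

theorem theorem1p6 {F : Type*} [Field F] [Fintype F] (hq : Odd (Fintype.card F))
    (d : ℕ) (E : Finset (Fin d → F)) (r : F) :
    (5 ≤ Fintype.card F → 2 ≤ d → d ≤ 4 → Even d → r ≠ 0 →
      36 * (Fintype.card F : ℝ) ^ ((2 * (d : ℝ) + 1) / 3) ≤ (E.card : ℝ) →
      ContainsPair (kPath 4) E r) ∧
    (d = 3 → r ≠ 0 → IsSquare r →
      9 * (Fintype.card F : ℝ) ^ ((2 * (d : ℝ) + 1) / 3) ≤ (E.card : ℝ) →
      ContainsPair (kPath 4) E r) ∧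
    (d = 5 → r ≠ 0 → IsSquare r →
      12 * (Fintype.card F : ℝ) ^ (3 : ℕ) ≤ (E.card : ℝ) →
      ContainsPair (kPath 4) E r) ∧
    (5 ≤ Fintype.card F → 6 ≤ d → Even d → r ≠ 0 →
      313 * (Fintype.card F : ℝ) ^ ((d : ℝ) / 2) ≤ (E.card : ℝ) →
      ContainsPair (kPath 4) E r) ∧
    (7 ≤ d → Odd d → r ≠ 0 → IsSquare r →
      313 * (Fintype.card F : ℝ) ^ ((d : ℝ) / 2) ≤ (E.card : ℝ) →
      ContainsPair (kPath 4) E r) := by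
  have hq3 : (3 : ℝ) ≤ Fintype.card F := by
    have := Fintype.one_lt_card (α := F)
    obtain ⟨k, hk⟩ := hq
    exact_mod_cast (by omega : 3 ≤ Fintype.card F)
  have hcore := fun (hr : r ≠ 0) (h : Even d ∨ IsSquare r) =>
    containsPair_of_card_ge hq (E := E) hr h
  generalize (Fintype.card F : ℝ) = q at *
  have hq0 : 0 < q := by linarith
  have hq1 : 1 ≤ q := by linarith
  have large : 6 ≤ d → 313 * q ^ ((d : ℝ) / 2) ≤ (E.card : ℝ) →
      400 * q ^ d ≤ (E.card : ℝ) ^ 2 ∧ 27 * q ≤ E.card := by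
    intro hd hE
    have h2 := rpow_div_pow hq0.le (d : ℝ) (k := 2) (n := d) (by norm_num) rfl
    push_cast at h2
    have hp : 0 ≤ q ^ ((d : ℝ) / 2) := by positivity
    refine ⟨?_, ?_⟩
    · rw [← h2]; nlinarith
    · have : q ≤ q ^ ((d : ℝ) / 2) := by
        conv_lhs => rw [← Real.rpow_one q]
        refine Real.rpow_le_rpow_of_exponent_le hq1 ?_
        have : (6 : ℝ) ≤ d := by exact_mod_cast hd
        linarith
      linarith
  refine ⟨?_, ?_, ?_, ?_, ?_⟩
  · intro _ hd2 hd4 hd hr hE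
    -- Here d/2 ≤ (2d + 1)/3, and 36 exceeds both 20 = √400 and 27.
    have hE2 : 36 * q ^ ((d : ℝ) / 2) ≤ (E.card : ℝ) := by
      refine le_trans ?_ hE
      gcongr 36 * ?_
      refine Real.rpow_le_rpow_of_exponent_le hq1 ?_
      linarith [(Nat.cast_nonneg d : (0 : ℝ) ≤ d)]
    have h2 := rpow_div_pow hq0.le (d : ℝ) (k := 2) (n := d) (by norm_num) rfl
    push_cast at h2
    have hp : 0 ≤ q ^ ((d : ℝ) / 2) := by positivity
    refine hcore hr (Or.inl hd) ?_ ?_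
    · rw [← h2]; nlinarith
    · have : q ≤ q ^ ((d : ℝ) / 2) := by
        conv_lhs => rw [← Real.rpow_one q]
        refine Real.rpow_le_rpow_of_exponent_le hq1 ?_
        have : (2 : ℝ) ≤ d := by exact_mod_cast hd2
        linarith
      linarith
  · intro hd hr hs hE
    have h3 := rpow_div_pow hq0.le (2 * (d : ℝ) + 1) (k := 3) (n := 7) (by norm_num)
      (by rw [hd]; norm_num)
    push_cast at h3
    set p := q ^ ((2 * (d : ℝ) + 1) / 3)
    have hp : 0 ≤ p := by positivity
    refine hcore hr (Or.inr hs) ?_ ?_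
    -- The factor 5 suffices because 9² · 5 = 405 ≥ 400.
    · have hp2 : 5 * q ^ 3 ≤ p ^ 2 := by
        refine le_of_pow_le_pow_left₀ (n := 3) (by norm_num) (by positivity) ?_
        calc (5 * q ^ 3) ^ 3 = 125 * q ^ 9 := by ring
          _ ≤ 3 ^ 5 * q ^ 9 := by gcongr; norm_num
          _ ≤ q ^ 5 * q ^ 9 := by gcongr
          _ = (p ^ 3) ^ 2 := by rw [h3]; ring
          _ = (p ^ 2) ^ 3 := by ring
      rw [show q ^ d = q ^ 3 by rw [hd]]
      nlinarith
    · have hp1 : 3 * q ≤ p := by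
        refine le_of_pow_le_pow_left₀ (n := 3) (by norm_num) hp ?_
        calc (3 * q) ^ 3 = 3 ^ 3 * q ^ 3 * 1 := by ring
          _ ≤ q ^ 3 * q ^ 3 * q := by gcongr
          _ = p ^ 3 := by rw [h3]; ring
      linarith
  · intro hd hr hs hE
    refine hcore hr (Or.inr hs) ?_ ?_
    · rw [show q ^ d = q ^ 5 by rw [hd]]
      -- One factor q ≥ 3 of the surplus is used: 144 · 3 = 432.
      calc 400 * q ^ 5 ≤ 144 * 3 * q ^ 5 := by gcongr; norm_num
        _ ≤ 144 * q * q ^ 5 := by gcongr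
        _ = (12 * q ^ 3) ^ 2 := by ring
        _ ≤ (E.card : ℝ) ^ 2 := by gcongr
    · calc 27 * q ≤ 12 * 3 * 1 * q := by linarith
        _ ≤ 12 * q * q * q := by gcongr
        _ = 12 * q ^ 3 := by ring
        _ ≤ E.card := hE
  · intro _ hd he hr hE
    exact hcore hr (Or.inl he) (large hd hE).1 (large hd hE).2
  · intro hd _ hr hs hE
    exact hcore hr (Or.inr hs) (large (by omega) hE).1 (large (by omega) hE).2

end Assembly
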